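/- Conventions. A \emph{left quasigroup} is a non-empty set $X$ with a binary operation $\cdot$ such that every $\sigma_x\colon y\mapsto x\cdot y$ is bijective; $\mathcal G(X)=\langle \sigma_x : x\in X\rangle\le \mathrm{Sym}(X)$, and $\mathrm{Dis}(X)$ is the normal closure in $\mathcal G(X)$ of $\{\sigma_x\sigma_y^{-1} : x,y\in X\}$. $X$ is \emph{simple} if $\mathcal G(X)$ is transitive on $X$ and the only congruences of $X$ (equivalence relations compatible with $x\cdot y$ and with $\sigma_x^{-1}(y)$) are the equality relation and the total relation. A \emph{cycle set} is a left quasigroup with $(x\cdot y)\cdot(x\cdot z)=(y\cdot x)\cdot(y\cdot z)$ for all $x,y,z$ and with $x\mapsto x\cdot x$ bijective. It is \emph{trivial} if for some $\gamma\in\mathrm{Sym}(X)$ one has $x\cdot y=\gamma(y)$ for all $x,y$. A normal subgroup $H$ of a group $G$ is \emph{invariant} under a map $f\colon G\to G$ if $x^{-1}y\in H$ implies $f(x)^{-1}f(y)\in H$ for all $x,y\in G$. Theorem. Let $p$ be a prime, $k\ge 0$, $G$ a group of order $p^k$, $\phi\in\mathrm{Sym}(G)$ and $\psi\in\mathrm{Aut}(G)$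 such that $$\phi(\phi(y)\psi(x))\,\psi(\phi(y))=\phi(\phi(x)\psi(y))\,\psi(\phi(x))\qquad\text{for all }x,y\in G, \tag{1}$$ and such that $$\text{no normal subgroup } H \text{ of } G \text{ with } 1\neq H\neq G \text{ is invariant under both } \psi \text{ and } \phi. \tag{2}$$ Then $X=G$ with $x\bullet y=\phi(x)\psi(y)$ is a simple cycle set with $\mathrm{Dis}(X)\cong G$, and it is non-trivial whenever $k\ge 1$. Conversely, every finite simple cycle set $X$ whose displacement group $\mathrm{Dis}(X)$ is nilpotent and acts regularly on $X$ is isomorphic to $(G,\bullet)$ for some $p,k,G,\phi,\psi$ as above, that is, with $p$ prime, $|G|=p^k$, and (1) and (2) satisfied. -/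

import Mathlib

universe u v

/-- A left quasigroup on `X`: `X` is non-empty and every left multiplication `y ↦ x · y` is
bijective. -/
structure LeftQuasigroup (X : Type*) where
  /-- the binary operation `x · y` -/
  op : X → X → X
  bijective_op : ∀ x, Function.Bijective (op x)
  nonempty : Nonempty X

namespace LeftQuasigroup

/-- The left multiplication `σ_x : y ↦ x · y` as a permutation of `X`. -/
noncomputable def sigma {X : Type*} (Q : LeftQuasigroup X) (x : X) : Equiv.Perm X :=
  Equiv.ofBijective (Q.op x) (Q.bijective_op x)

/-- The associated permutation group `𝒢(X) = ⟨σ_x ∣ x ∈ X⟩ ≤ Sym(X)`. -/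
def permGroup {X : Type*} (Q : LeftQuasigroup X) : Subgroup (Equiv.Perm X) :=
  Subgroup.closure (Set.range Q.sigma)

/-- The displacement group `Dis(X)`: the normal closure in `𝒢(X)` of all `σ_x σ_y⁻¹`. -/
def dis {X : Type*} (Q : LeftQuasigroup X) : Subgroup Q.permGroup :=
  Subgroup.normalClosure
    {g : Q.permGroup | ∃ x y : X, (g : Equiv.Perm X) = Q.sigma x * (Q.sigma y)⁻¹}

/-- The displacement group acts regularly (sharply transitively) on `X`. -/
def DisIsRegular {X : Type*} (Q : LeftQuasigroup X) : Prop :=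
  ∀ x y : X, ∃! g : Q.dis, ((g : Q.permGroup) : Equiv.Perm X) x = y

/-- `X` is indecomposable if `𝒢(X)` is transitive on `X`. -/
def IsIndecomposable {X : Type*} (Q : LeftQuasigroup X) : Prop :=
  ∀ x y : X, ∃ g ∈ Q.permGroup, g x = y

/-- Congruences: equivalence relations compatible with `x · y` and with the left division
`σ_x⁻¹(y)`. -/
def IsCongruence {X : Type*} (Q : LeftQuasigroup X) (r : Setoid X) : Prop :=
  ∀ x x' y y' : X, r x x' → r y y' →
    r (Q.op x y) (Q.op x' y') ∧ r ((Q.sigma x)⁻¹ y) ((Q.sigma x')⁻¹ y')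

/-- A left quasigroup is simple if it is indecomposable and its only congruences are the
equality relation and the total relation. -/
def IsSimple {X : Type*} (Q : LeftQuasigroup X) : Prop :=
  Q.IsIndecomposable ∧ ∀ r : Setoid X, Q.IsCongruence r → r = ⊥ ∨ r = ⊤

/-- A (non-degenerate) cycle set: the cycle set identity holds, and the squaring map
`x ↦ x · x` is bijective. -/
structure IsCycleSet {X : Type*} (Q : LeftQuasigroup X) : Prop where
  cycle : ∀ x y z : X, Q.op (Q.op x y) (Q.op x z) = Q.op (Q.op y x) (Q.op y z)
  nondegenerate : Function.Bijective fun x : X => Q.op x x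

/-- Trivial cycle sets: `x · y = γ(y)` for a fixed permutation `γ`. -/
def IsTrivial {X : Type*} (Q : LeftQuasigroup X) : Prop :=
  ∃ γ : Equiv.Perm X, ∀ x y : X, Q.op x y = γ y

/-- Existence of an isomorphism (a bijective homomorphism) of left quasigroups. -/
def IsIsomorphic {X Y : Type*} (Q : LeftQuasigroup X) (R : LeftQuasigroup Y) : Prop :=
  ∃ e : X ≃ Y, ∀ x y : X, e (Q.op x y) = R.op (e x) (e y)

/-- The left quasigroup `x • y = φ(x) ψ(y)`, right linear over the group `G`. -/
def rightLinear {G : Type*} [Group G] (φ : Equiv.Perm G) (ψ : MulAut G) : LeftQuasigroup G where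
  op x y := φ x * ψ y
  bijective_op x := (Group.mulLeft_bijective (φ x)).comp ψ.bijective
  nonempty := ⟨1⟩

end LeftQuasigroup

/-- The subgroup `H` is invariant under the map `f : G → G`:
`x⁻¹ y ∈ H` implies `f(x)⁻¹ f(y) ∈ H`. -/
def Subgroup.IsInvariantUnder {G : Type*} [Group G] (H : Subgroup G) (f : G → G) : Prop :=
  ∀ x y : G, x⁻¹ * y ∈ H → (f x)⁻¹ * f y ∈ H

/-- The right-linear cycle set identity for `(φ, ψ)`. -/
def RightLinearCondition {G : Type*} [Group G] (φ : Equiv.Perm G) (ψ : MulAut G) : Prop :=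
  ∀ x y : G, φ (φ y * ψ x) * ψ (φ y) = φ (φ x * ψ y) * ψ (φ x)

/-- No normal subgroup of `G`, other than the two which are invariant under every map
(the trivial subgroup and `G` itself), is invariant under both `ψ` and `φ`. -/
def NoInvariantNormalSubgroup {G : Type*} [Group G] (φ : Equiv.Perm G) (ψ : MulAut G) : Prop :=
  ∀ H : Subgroup G, H.Normal → H ≠ ⊥ → H ≠ ⊤ →
    H.IsInvariantUnder ψ → ¬ H.IsInvariantUnder φ

/-!
A right-linear operation `x • y = φ(x) ψ(y)` on a group `G` is built so that `σ_x σ_y⁻¹` is left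
multiplication by `φ(x) φ(y)⁻¹`. As `φ` is onto, the displacement group consists of all left
multiplications (`dis_rightLinear`). A congruence is therefore the left coset relation of a subgroup
`H`, and compatibility of `•` with it in the first argument forces the differences of `φ` on a coset
of `H` into the normal core of `H`; if `G` is finite, counting gives that `H` is normal, and it is
invariant under `φ` and `ψ` (`isSimple_rightLinear`). Non-degeneracy is automatic for finite cycle
sets (`CycleIdentity.bijective_square`): the cycle set identity makes
`λ_{x + a} = σ_{λ_a(x)} λ_a` a well-defined function of the multiset `a`, and the iterates of the
squaring map at `x` are `λ_{n x}(x)`.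

For the converse, the values of `λ` turn the multisets modulo `λ_a = λ_b` into a finite abelian group
`A` on which `𝒢(X)` acts and to which it has a bijective `1`-cocycle `π` with `π(σ_x⁻¹) = [x]`
(`exists_bijective_cocycle`). The differences `[x] - [y]` generate a subgroup `A₀` whose preimage lies
in `Dis(X)`. For a prime `p` dividing `|A₀|`, let `P` be the preimage of the `p`-primary part `B` of
`A₀`. Since `Dis(X)` is nilpotent, `P` commutes with the preimage of the part of `A₀` of order prime
to `p`, so it acts trivially on that part, and comparing orders of a homomorphism shows
`d a - a ∈ B` for all `d ∈ P` and `a ∈ A` (`smul_sub_mem_torsionIn`). Hence `P` is normal in `𝒢(X)`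
and its orbits form a congruence. By simplicity `P` is trivial, which Cauchy's theorem excludes, or
transitive, and then regularity gives `P = Dis(X)`, a `p`-group (`exists_card_dis_eq_prime_pow`).
Finally the evaluation of `Dis(X)` at a point fixed by a suitable `t` in the coset of the `σ_x`
transports the operation of `X` to a right-linear one on `Dis(X)`; here `φ` is injective because the
relation `σ_x = σ_y` is a congruence (`exists_rightLinear_isomorphic`).
-/

namespace LeftQuasigroup

/-! ### Congruences of finite left quasigroups -/

section Basic

variable {X : Type*} (Q : LeftQuasigroup X)

@[simp]
theorem sigma_apply (x y : X) : Q.sigma x y = Q.op x y := rfl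

theorem sigma_mem_permGroup (x : X) : Q.sigma x ∈ Q.permGroup :=
  Subgroup.subset_closure ⟨x, rfl⟩

/-- `σ_x` as an element of `𝒢(X)`. -/
noncomputable def sigmaG (x : X) : Q.permGroup := ⟨Q.sigma x, Q.sigma_mem_permGroup x⟩

theorem sigmaG_mul_inv_mem_dis (x y : X) : Q.sigmaG x * (Q.sigmaG y)⁻¹ ∈ Q.dis :=
  Subgroup.subset_normalClosure ⟨x, y, rfl⟩

instance normal_dis : Q.dis.Normal := Subgroup.normalClosure_normal

theorem sigmaG_inv_mul_mem_dis (x y : X) : (Q.sigmaG x)⁻¹ * Q.sigmaG y ∈ Q.dis :=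
  Q.normal_dis.mem_comm (Q.sigmaG_mul_inv_mem_dis y x)

variable {Q}

/-- On a finite set, compatibility with left division is automatic: `σ_x⁻¹` is the power
`σ_x ^ (|Sym(X)| - 1)`. -/
theorem isCongruence_of_op [Finite X] {r : Setoid X}
    (h : ∀ x x' y y' : X, r x x' → r y y' → r (Q.op x y) (Q.op x' y')) : Q.IsCongruence r := by
  intro x x' y y' hx hy
  refine ⟨h x x' y y' hx hy, ?_⟩
  have key (n : ℕ) : r ((Q.sigma x ^ n) y) ((Q.sigma x' ^ n) y') := by
    induction n with
    | zero => simpa using hy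
    | succ n ih =>
      rw [pow_succ', pow_succ', Equiv.Perm.mul_apply, Equiv.Perm.mul_apply]
      exact h _ _ _ _ hx ih
  have hinv (z : X) : (Q.sigma z)⁻¹ = Q.sigma z ^ (Nat.card (Equiv.Perm X) - 1) := by
    rw [inv_eq_iff_mul_eq_one, ← pow_succ', Nat.sub_add_cancel Nat.card_pos, pow_card_eq_one']
  rw [hinv, hinv]
  exact key _

theorem IsCongruence.apply_perm {r : Setoid X} (h : Q.IsCongruence r) {g : Equiv.Perm X}
    (hg : g ∈ Q.permGroup) {x y : X} (hxy : r x y) : r (g x) (g y) := by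
  induction hg using Subgroup.closure_induction'' generalizing x y with
  | mem g hg =>
    obtain ⟨z, rfl⟩ := hg
    exact (h z z x y (r.refl z) hxy).1
  | inv_mem g hg =>
    obtain ⟨z, rfl⟩ := hg
    exact (h z z x y (r.refl z) hxy).2
  | one => exact hxy
  | mul g g' _ _ ih ih' => exact ih (ih' hxy)

/-- The retraction relation `σ_x = σ_y` of a finite cycle set is a congruence. -/
theorem isCongruence_ker_sigma [Finite X]
    (hc : ∀ x y z : X, Q.op (Q.op x y) (Q.op x z) = Q.op (Q.op y x) (Q.op y z)) :
    Q.IsCongruence (Setoid.ker Q.sigma) := by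
  have hop {x x' : X} (h : Q.sigma x = Q.sigma x') (z : X) : Q.op x z = Q.op x' z :=
    DFunLike.congr_fun h z
  refine isCongruence_of_op fun x x' y y' hx hy => Equiv.ext fun w => ?_
  obtain ⟨z, rfl⟩ := (Q.bijective_op x).2 w
  simp only [sigma_apply]
  rw [hc, hop hy, hop hy, hc, hop hx y', hop hx z]

end Basic

/-! ### The cocycle on multisets and non-degeneracy -/

section Cocycle

variable {X : Type*} (Q : LeftQuasigroup X)

/-- The cycle set identity, as an assertion separate from non-degeneracy. -/
def CycleIdentity : Prop :=
  ∀ x y z : X, Q.op (Q.op x y) (Q.op x z) = Q.op (Q.op y x) (Q.op y z)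

/-- One step of the recursion defining `multisetPerm`. -/
noncomputable def cocycleStep (x : X) (g : Equiv.Perm X) : Equiv.Perm X := Q.sigma (g x) * g

variable {Q}

theorem CycleIdentity.leftCommutative (hc : Q.CycleIdentity) : LeftCommutative Q.cocycleStep where
  left_comm x y g := Equiv.ext fun z => by simp [cocycleStep, hc (g x) (g y) (g z)]

/-- The permutation `λ_a` attached to a finite multiset `a` by `λ_0 = 1` and
`λ_{x + a} = σ_{λ_a(x)} λ_a`; the cycle set identity says exactly that the order in which the
elements of `a` are added does not matter. -/
noncomputable def multisetPerm (hc : Q.CycleIdentity) (a : Multiset X) : Equiv.Perm X :=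
  haveI := hc.leftCommutative
  Multiset.foldr Q.cocycleStep 1 a

variable (hc : Q.CycleIdentity)

theorem multisetPerm_zero : multisetPerm hc 0 = 1 := rfl

theorem multisetPerm_cons (x : X) (a : Multiset X) :
    multisetPerm hc (x ::ₘ a) = Q.sigma (multisetPerm hc a x) * multisetPerm hc a :=
  haveI := hc.leftCommutative
  Multiset.foldr_cons Q.cocycleStep 1 x a

theorem multisetPerm_singleton (x : X) : multisetPerm hc {x} = Q.sigma x :=
  multisetPerm_cons hc x 0

theorem multisetPerm_add_congr {a b : Multiset X} (h : multisetPerm hc a = multisetPerm hc b)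
    (c : Multiset X) : multisetPerm hc (a + c) = multisetPerm hc (b + c) := by
  induction c using Multiset.induction_on with
  | empty => simpa using h
  | cons x c ih => rw [Multiset.add_cons, Multiset.add_cons, multisetPerm_cons,
      multisetPerm_cons, ih]

/-- The composition law `λ_{a + λ_a⁻¹(c)} = λ_c λ_a`. -/
theorem multisetPerm_add_map (a c : Multiset X) :
    multisetPerm hc (a + c.map ⇑(multisetPerm hc a)⁻¹) = multisetPerm hc c * multisetPerm hc a := by
  induction c using Multiset.induction_on with
  | empty => simp [multisetPerm_zero]
  | cons x c ih =>
    rw [Multiset.map_cons, Multiset.add_cons, multisetPerm_cons, ih, multisetPerm_cons]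
    simp [mul_assoc]

theorem multisetPerm_mem_permGroup (a : Multiset X) : multisetPerm hc a ∈ Q.permGroup := by
  induction a using Multiset.induction_on with
  | empty => exact one_mem _
  | cons x a ih =>
    rw [multisetPerm_cons]
    exact mul_mem (Q.sigma_mem_permGroup _) ih

theorem exists_multisetPerm_mul (a b : Multiset X) :
    ∃ c, multisetPerm hc c = multisetPerm hc a * multisetPerm hc b :=
  ⟨_, multisetPerm_add_map hc b a⟩

theorem multisetPerm_nsmul_singleton_apply (n : ℕ) (x : X) :
    multisetPerm hc (n • {x}) x = (fun y => Q.op y y)^[n] x := by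
  induction n with
  | zero => rw [zero_nsmul]; rfl
  | succ n ih =>
    rw [succ_nsmul, add_comm, Multiset.singleton_add, multisetPerm_cons,
      Function.iterate_succ_apply', ← ih]
    rfl

variable [Finite X]

theorem exists_multisetPerm_inv (a : Multiset X) :
    ∃ c, multisetPerm hc c = (multisetPerm hc a)⁻¹ := by
  have key (n : ℕ) : ∃ c, multisetPerm hc c = multisetPerm hc a ^ n := by
    induction n with
    | zero => exact ⟨0, multisetPerm_zero hc⟩
    | succ n ih =>
      obtain ⟨c, hc'⟩ := ih
      obtain ⟨d, hd⟩ := exists_multisetPerm_mul hc c a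
      exact ⟨d, by rw [hd, hc', pow_succ]⟩
  obtain ⟨c, h⟩ := key (Nat.card (Equiv.Perm X) - 1)
  refine ⟨c, ?_⟩
  rw [h, eq_inv_iff_mul_eq_one, ← pow_succ, Nat.sub_add_cancel Nat.card_pos, pow_card_eq_one']

theorem exists_multisetPerm_add_eq_one (a : Multiset X) :
    ∃ c, multisetPerm hc (a + c) = 1 := by
  obtain ⟨b, hb⟩ := exists_multisetPerm_inv hc a
  exact ⟨_, by rw [multisetPerm_add_map hc a b, hb, inv_mul_cancel]⟩

theorem multisetPerm_add_left_cancel {a b c : Multiset X}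
    (h : multisetPerm hc (c + a) = multisetPerm hc (c + b)) :
    multisetPerm hc a = multisetPerm hc b := by
  obtain ⟨d, hd⟩ := exists_multisetPerm_add_eq_one hc c
  have key (e : Multiset X) : multisetPerm hc (c + e + d) = multisetPerm hc e := by
    rw [add_right_comm]
    simpa using multisetPerm_add_congr hc (hd.trans (multisetPerm_zero hc).symm) e
  rw [← key a, ← key b]
  exact multisetPerm_add_congr hc h d

theorem exists_multisetPerm_eq {g : Equiv.Perm X} (hg : g ∈ Q.permGroup) :
    ∃ a, multisetPerm hc a = g := by
  induction hg using Subgroup.closure_induction with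
  | mem g hg =>
    obtain ⟨x, rfl⟩ := hg
    exact ⟨{x}, multisetPerm_singleton hc x⟩
  | one => exact ⟨0, multisetPerm_zero hc⟩
  | mul g g' _ _ ih ih' =>
    obtain ⟨a, rfl⟩ := ih
    obtain ⟨b, rfl⟩ := ih'
    exact exists_multisetPerm_mul hc a b
  | inv g _ ih =>
    obtain ⟨a, rfl⟩ := ih
    exact exists_multisetPerm_inv hc a

theorem multisetPerm_map_congr {g : Equiv.Perm X} (hg : g ∈ Q.permGroup) {a b : Multiset X}
    (h : multisetPerm hc a = multisetPerm hc b) :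
    multisetPerm hc (a.map g) = multisetPerm hc (b.map g) := by
  obtain ⟨c, hc'⟩ := exists_multisetPerm_eq hc (inv_mem hg)
  have hg' : g = (multisetPerm hc c)⁻¹ := by rw [hc', inv_inv]
  apply multisetPerm_add_left_cancel hc (c := c)
  rw [hg', multisetPerm_add_map, multisetPerm_add_map, h]

/-- Rump's theorem: a finite cycle set is non-degenerate. The iterates of the squaring map `T` are
`T^n(x) = λ_{n x}(x)`, and `λ_{n x} = 1` for some `n > 0`, so that every point is periodic. -/
theorem CycleIdentity.bijective_square (hc : Q.CycleIdentity) :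
    Function.Bijective fun x : X => Q.op x x := by
  apply Function.Injective.bijective_of_finite
  have per (x : X) : ∃ n, (fun y => Q.op y y)^[n + 1] x = x := by
    obtain ⟨m, n, hmn, h⟩ := Finite.exists_ne_map_eq_of_infinite
      fun n : ℕ => multisetPerm hc (n • {x})
    wlog hlt : n < m generalizing m n
    · exact this n m hmn.symm h.symm (by omega)
    obtain ⟨k, rfl⟩ := Nat.exists_eq_add_of_lt hlt
    refine ⟨k, ?_⟩
    have h1 : multisetPerm hc ((k + 1) • {x}) = multisetPerm hc 0 := by
      apply multisetPerm_add_left_cancel hc (c := n • {x})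
      rw [← add_nsmul, add_zero]
      exact h
    rw [← multisetPerm_nsmul_singleton_apply hc, h1]
    rfl
  intro x y hxy
  obtain ⟨m, hm⟩ := per x
  obtain ⟨n, hn⟩ := per y
  -- After a common multiple of both periods, the orbits of `x` and `y` agree and are back at
  -- their starting points.
  have hx : (fun y => Q.op y y)^[(m + 1) * (n + 1)] x = x := by
    rw [Function.iterate_mul]
    exact Function.iterate_fixed hm _
  have hy : (fun y => Q.op y y)^[(m + 1) * (n + 1)] y = y := by
    rw [mul_comm, Function.iterate_mul]
    exact Function.iterate_fixed hn _
  obtain ⟨k, hk⟩ : ∃ k, (m + 1) * (n + 1) = k + 1 := ⟨m * n + m + n, by ring⟩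
  rw [← hx, ← hy, hk, Function.iterate_succ_apply, Function.iterate_succ_apply]
  exact congrArg _ hxy

end Cocycle

/-! ### Right-linear cycle sets -/

section RightLinear

variable {G : Type*} [Group G] {φ : Equiv.Perm G} {ψ : MulAut G}

theorem rightLinear_op (x y : G) : (rightLinear φ ψ).op x y = φ x * ψ y := rfl

theorem cycleIdentity_rightLinear_iff :
    (rightLinear φ ψ).CycleIdentity ↔ RightLinearCondition φ ψ := by
  have key (x y z : G) : φ (φ x * ψ y) * ψ (φ x * ψ z) =
      φ (φ x * ψ y) * ψ (φ x) * ψ (ψ z) := by rw [map_mul ψ, mul_assoc]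
  constructor
  · intro h x y
    have := h y x 1
    simpa only [rightLinear_op, key, mul_left_inj] using this
  · intro h x y z
    simp only [rightLinear_op, key, mul_left_inj]
    exact h y x

theorem rightLinear_sigma_mul_inv (x y z : G) :
    ((rightLinear φ ψ).sigma x * ((rightLinear φ ψ).sigma y)⁻¹) z = φ x * (φ y)⁻¹ * z := by
  obtain ⟨w, rfl⟩ := ((rightLinear φ ψ).sigma y).surjective z
  rw [Equiv.Perm.mul_apply, Equiv.Perm.inv_def, Equiv.symm_apply_apply]
  simp [rightLinear_op, mul_assoc]

variable (φ ψ)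

theorem mulLeft_mem_permGroup (g : G) : Equiv.mulLeft g ∈ (rightLinear φ ψ).permGroup := by
  obtain ⟨x, rfl⟩ := φ.surjective g
  obtain ⟨y, hy⟩ := φ.surjective 1
  have : Equiv.mulLeft (φ x) = (rightLinear φ ψ).sigma x * ((rightLinear φ ψ).sigma y)⁻¹ :=
    Equiv.ext fun z => by rw [rightLinear_sigma_mul_inv, hy]; simp
  rw [this]
  exact mul_mem (sigma_mem_permGroup _ _) (inv_mem (sigma_mem_permGroup _ _))

/-- The left regular representation of `G`, with values in `𝒢(G, •)`. -/
def leftRegular : G →* (rightLinear φ ψ).permGroup :=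
  (MulAction.toPermHom G G).codRestrict _ fun g => mulLeft_mem_permGroup φ ψ g

theorem leftRegular_apply (g z : G) : (leftRegular φ ψ g : Equiv.Perm G) z = g * z := rfl

theorem leftRegular_injective : Function.Injective (leftRegular φ ψ) := by
  intro g h hgh
  simpa [leftRegular_apply] using
    congrArg (fun k : (rightLinear φ ψ).permGroup => (k : Equiv.Perm G) 1) hgh

theorem normal_range_leftRegular : (leftRegular φ ψ).range.Normal := by
  rw [← Subgroup.normalizer_eq_top_iff]
  have key (x : G) : (rightLinear φ ψ).sigmaG x ∈
      Subgroup.normalizer ((leftRegular φ ψ).range : Set (rightLinear φ ψ).permGroup) := by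
    have conj (g : G) : (rightLinear φ ψ).sigmaG x * leftRegular φ ψ g *
        ((rightLinear φ ψ).sigmaG x)⁻¹ = leftRegular φ ψ (φ x * ψ g * (φ x)⁻¹) := by
      rw [mul_inv_eq_iff_eq_mul]
      refine Subtype.ext (Equiv.ext fun z => ?_)
      change φ x * ψ (g * z) = φ x * ψ g * (φ x)⁻¹ * (φ x * ψ z)
      rw [map_mul]
      group
    rw [Subgroup.mem_normalizer_iff]
    intro h
    constructor
    · rintro ⟨g, rfl⟩
      exact ⟨_, (conj g).symm⟩
    · rintro ⟨g, hg⟩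
      refine ⟨ψ.symm ((φ x)⁻¹ * g * φ x), ?_⟩
      have := conj (ψ.symm ((φ x)⁻¹ * g * φ x))
      rw [MulEquiv.apply_symm_apply] at this
      rw [show φ x * ((φ x)⁻¹ * g * φ x) * (φ x)⁻¹ = g by group, hg] at this
      simpa using this
  rw [eq_top_iff]
  rintro ⟨g, hg⟩ -
  induction hg using Subgroup.closure_induction with
  | mem g hg =>
    obtain ⟨x, rfl⟩ := hg
    exact key x
  | one => exact one_mem _
  | mul g g' h h' ih ih' => exact mul_mem ih ih'
  | inv g h ih => exact inv_mem ih

theorem dis_rightLinear : (rightLinear φ ψ).dis = (leftRegular φ ψ).range := by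
  apply le_antisymm
  · have := normal_range_leftRegular φ ψ
    apply Subgroup.normalClosure_le_normal
    rintro g ⟨x, y, hg⟩
    refine ⟨φ x * (φ y)⁻¹, Subtype.ext (Equiv.ext fun z => ?_)⟩
    rw [hg, rightLinear_sigma_mul_inv, leftRegular_apply]
  · rintro _ ⟨g, rfl⟩
    obtain ⟨x, rfl⟩ := φ.surjective g
    obtain ⟨y, hy⟩ := φ.surjective 1
    refine Subgroup.subset_normalClosure ⟨x, y, Equiv.ext fun z => ?_⟩
    rw [rightLinear_sigma_mul_inv, hy, leftRegular_apply]
    simp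

theorem nonempty_dis_rightLinear_mulEquiv : Nonempty ((rightLinear φ ψ).dis ≃* G) := by
  rw [dis_rightLinear]
  exact ⟨(MonoidHom.ofInjective (leftRegular_injective φ ψ)).symm⟩

theorem isIndecomposable_rightLinear : (rightLinear φ ψ).IsIndecomposable := fun x y =>
  ⟨_, mulLeft_mem_permGroup φ ψ (y * x⁻¹), by simp⟩

variable {φ ψ}

/-- If the differences of the bijection `φ` within each left coset of `H` lie in the normal core of
`H`, then `φ` embeds `H` into a coset of its normal core, and finiteness gives equality. -/
theorem normal_of_differences_mem_normalCore [Finite G] {H : Subgroup G}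
    (h : ∀ x y : G, x⁻¹ * y ∈ H → (φ x)⁻¹ * φ y ∈ H.normalCore) : H.Normal := by
  have hcard : Nat.card H ≤ Nat.card H.normalCore := by
    refine Nat.card_le_card_of_injective
      (fun x : H => (⟨(φ 1)⁻¹ * φ x, h 1 x (by simp)⟩ : H.normalCore)) fun x y hxy => ?_
    simpa using hxy
  rw [← Subgroup.eq_of_le_of_card_ge H.normalCore_le hcard]
  infer_instance

theorem isSimple_rightLinear [Finite G] (h : NoInvariantNormalSubgroup φ ψ) :
    (rightLinear φ ψ).IsSimple := by
  refine ⟨isIndecomposable_rightLinear φ ψ, fun r hr => ?_⟩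
  have hmul (g : G) {x y : G} (hxy : r x y) : r (g * x) (g * y) :=
    hr.apply_perm (mulLeft_mem_permGroup φ ψ g) hxy
  -- A congruence is invariant under left translations, hence the left coset relation of a
  -- subgroup.
  let H : Subgroup G :=
    { carrier := {x | r 1 x}
      one_mem' := r.refl 1
      mul_mem' := fun {x y} hx hy => r.trans hx (by simpa using hmul x hy)
      inv_mem' := fun {x} hx => r.symm (by simpa using hmul x⁻¹ hx) }
  have hH (x y : G) : x⁻¹ * y ∈ H ↔ r x y :=
    ⟨fun h => by simpa using hmul x h, fun h => by
      change r 1 (x⁻¹ * y)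
      simpa using hmul x⁻¹ h⟩
  have hψ : H.IsInvariantUnder ψ := by
    intro x y hxy
    rw [hH] at hxy ⊢
    obtain ⟨z, hz⟩ := φ.surjective 1
    simpa [rightLinear_op, hz] using (hr z z x y (r.refl z) hxy).1
  have hcore (x y : G) (hxy : x⁻¹ * y ∈ H) : (φ x)⁻¹ * φ y ∈ H.normalCore := by
    rw [hH] at hxy
    intro g
    obtain ⟨z, hz⟩ := ψ.surjective g⁻¹
    have := (hH _ _).2 (hr x y z z hxy (r.refl z)).1
    rw [rightLinear_op, rightLinear_op, hz] at this
    simpa [mul_assoc] using this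
  have hφ : H.IsInvariantUnder φ := fun x y hxy => H.normalCore_le (hcore x y hxy)
  have hn : H.Normal := normal_of_differences_mem_normalCore hcore
  by_cases h1 : H = ⊥
  · left
    ext x y
    rw [← hH, h1, Subgroup.mem_bot, inv_mul_eq_one]
    rfl
  by_cases h2 : H = ⊤
  · right
    ext x y
    rw [← hH, h2]
    exact ⟨fun _ => trivial, fun _ => trivial⟩
  exact absurd hφ (h H hn h1 h2 hψ)

theorem not_isTrivial_rightLinear [Nontrivial G] : ¬ (rightLinear φ ψ).IsTrivial := by
  rintro ⟨γ, hγ⟩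
  obtain ⟨x, y, hxy⟩ := exists_pair_ne G
  have h := (hγ x 1).trans (hγ y 1).symm
  rw [rightLinear_op, rightLinear_op, mul_left_inj] at h
  exact hxy (φ.injective h)

/-- A normal subgroup invariant under `φ` and `ψ` has a congruence as its coset relation, so a
simple finite cycle set isomorphic to `(G, •)` leaves no room for a proper one. -/
theorem noInvariantNormalSubgroup_of_isSimple {X : Type*} [Finite X] {Q : LeftQuasigroup X}
    (hs : Q.IsSimple) (hi : Q.IsIsomorphic (rightLinear φ ψ)) :
    NoInvariantNormalSubgroup φ ψ := by
  obtain ⟨e, he⟩ := hi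
  intro H hn h1 h2 hψ hφ
  let r : Setoid X := (QuotientGroup.leftRel H).comap e
  have hr (x y : X) : r x y ↔ (e x)⁻¹ * e y ∈ H := by
    rw [Setoid.comap_rel, QuotientGroup.leftRel_apply]
  have hcong : Q.IsCongruence r := by
    refine isCongruence_of_op fun x x' y y' hx hy => ?_
    rw [hr] at hx hy ⊢
    rw [he, he, rightLinear_op, rightLinear_op]
    have := H.mul_mem (hn.conj_mem _ (hφ _ _ hx) (ψ (e y))⁻¹) (hψ _ _ hy)
    simpa [mul_assoc] using this
  rcases hs.2 r hcong with h | h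
  · refine h1 ((Subgroup.eq_bot_iff_forall _).2 fun g hg => ?_)
    have : r (e.symm 1) (e.symm g) := by rw [hr]; simpa using hg
    rw [h] at this
    exact (e.symm.injective this).symm
  · refine h2 ((Subgroup.eq_top_iff' _).2 fun g => ?_)
    have : r (e.symm 1) (e.symm g) := by rw [h]; trivial
    rw [hr] at this
    simpa using this

end RightLinear

end LeftQuasigroup

/-! ### Elements of coprime order in finite nilpotent groups -/

theorem Group.IsNilpotent.commute_of_coprime_orderOf {D : Type*} [Group D] [Finite D]
    [Group.IsNilpotent D] {x y : D} (h : (orderOf x).Coprime (orderOf y)) : Commute x y := by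
  obtain ⟨e⟩ := (Group.isNilpotent_of_finite_tfae (G := D)).out 0 4 rfl rfl |>.mp ‹_›
  obtain ⟨x, rfl⟩ := e.surjective x
  obtain ⟨y, rfl⟩ := e.surjective y
  rw [MulEquiv.orderOf_eq, MulEquiv.orderOf_eq] at h
  refine Commute.map (f := e) (funext fun q => funext fun P => ?_)
  have hq : (q : ℕ).Prime := Nat.prime_of_mem_primeFactors q.2
  have := Fact.mk hq
  -- A `q`-component can only be non-trivial if `q` divides the order.
  have key (z : (p : (Nat.card D).primeFactors) → (P : Sylow p D) → P)
      (hz : z q P ≠ 1) : (q : ℕ) ∣ orderOf z := by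
    have h1 : orderOf (z q P) ∣ orderOf z := orderOf_dvd_of_pow_eq_one <| by
      rw [← Pi.pow_apply, ← Pi.pow_apply, pow_orderOf_eq_one, Pi.one_apply, Pi.one_apply]
    obtain ⟨n, hn⟩ := IsPGroup.iff_orderOf.1 P.isPGroup' (z q P)
    rw [hn] at h1
    refine (dvd_pow_self _ fun h0 => hz ?_).trans h1
    rw [← orderOf_eq_one_iff, hn, h0, pow_zero]
  by_cases hx : x q P = 1
  · simp [hx]
  by_cases hy : y q P = 1
  · simp [hy]
  have hdvd := Nat.dvd_gcd (key x hx) (key y hy)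
  rw [h] at hdvd
  exact absurd hdvd hq.not_dvd_one

/-! ### Bijective cocycles of finite groups -/

section BijectiveCocycle

variable {Γ A : Type*} [Group Γ] [AddCommGroup A] [DistribMulAction Γ A] {π : Γ ≃ A}

theorem cocycle_one (hπ : ∀ g h, π (g * h) = π g + g • π h) : π 1 = 0 := by
  simpa using hπ 1 1

theorem cocycle_inv (hπ : ∀ g h, π (g * h) = π g + g • π h) (g : Γ) :
    g • π g⁻¹ = -π g := by
  have := hπ g g⁻¹
  rw [mul_inv_cancel, cocycle_one hπ] at this
  exact (neg_eq_of_add_eq_zero_right this.symm).symm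

/-- The preimage of an invariant additive subgroup under a cocycle is a subgroup. -/
def cocyclePreimage (hπ : ∀ g h, π (g * h) = π g + g • π h) (B : AddSubgroup A)
    (hB : ∀ (g : Γ), ∀ b ∈ B, g • b ∈ B) : Subgroup Γ where
  carrier := {g | π g ∈ B}
  one_mem' := by
    change π 1 ∈ B
    rw [cocycle_one hπ]
    exact B.zero_mem
  mul_mem' := fun {g h} hg hh => by
    change π (g * h) ∈ B
    rw [hπ]
    exact B.add_mem hg (hB g _ hh)
  inv_mem' := fun {g} hg => by
    have : π g⁻¹ = g⁻¹ • -π g := by rw [← cocycle_inv hπ, inv_smul_smul]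
    change π g⁻¹ ∈ B
    rw [this]
    exact hB _ _ (B.neg_mem hg)

theorem card_cocyclePreimage (hπ : ∀ g h, π (g * h) = π g + g • π h) (B : AddSubgroup A)
    (hB : ∀ (g : Γ), ∀ b ∈ B, g • b ∈ B) : Nat.card (cocyclePreimage hπ B hB) = Nat.card B :=
  Nat.card_congr (π.subtypeEquiv fun _ => Iff.rfl)

/-- The elements of `A₀` killed by `n`. -/
def torsionIn (A₀ : AddSubgroup A) (n : ℕ) : AddSubgroup A := A₀ ⊓ (nsmulAddMonoidHom n).ker

theorem smul_mem_of_smul_sub_mem {A₀ : AddSubgroup A} (hA₀ : ∀ (g : Γ) (a : A), g • a - a ∈ A₀)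
    (g : Γ) {a : A} (ha : a ∈ A₀) : g • a ∈ A₀ := by
  simpa using A₀.add_mem (hA₀ g a) ha

theorem smul_mem_torsionIn {A₀ : AddSubgroup A} (hA₀ : ∀ (g : Γ) (a : A), g • a - a ∈ A₀)
    (n : ℕ) (g : Γ) (a : A) (ha : a ∈ torsionIn A₀ n) : g • a ∈ torsionIn A₀ n :=
  ⟨smul_mem_of_smul_sub_mem hA₀ g ha.1, by
    have h : n • a = 0 := ha.2
    change n • g • a = 0
    rw [smul_comm, h, smul_zero]⟩

theorem prime_dvd_of_dvd_card_torsionIn [Finite A] {A₀ : AddSubgroup A} {n q : ℕ} (hq : q.Prime)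
    (h : q ∣ Nat.card (torsionIn A₀ n)) : q ∣ n := by
  have := Fact.mk hq
  obtain ⟨b, hb⟩ := exists_prime_addOrderOf_dvd_card' q h
  rw [← hb]
  exact addOrderOf_dvd_of_nsmul_eq_zero (Subtype.ext b.2.2)

variable [Finite A]

/-- Let `D` be a nilpotent subgroup containing the preimage of `A₀`, and
let `|A₀| = s m` with `s` and `m` coprime. The preimage `P` of the `s`-torsion of `A₀` and the
preimage of the `m`-torsion have coprime orders, so they commute, whence `P` acts trivially on the
`m`-torsion. For `a` in `A`, the cocycle `d ↦ s (d a - a)` on `P` has values in the `m`-torsion, so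
it is a homomorphism between groups of coprime orders and vanishes. -/
theorem smul_sub_mem_torsionIn (hπ : ∀ g h, π (g * h) = π g + g • π h) {A₀ : AddSubgroup A}
    (hA₀ : ∀ (g : Γ) (a : A), g • a - a ∈ A₀) {D : Subgroup Γ} (hD : ∀ g, π g ∈ A₀ → g ∈ D)
    (hnil : Group.IsNilpotent D) {s m : ℕ} (hsm : s.Coprime m) (hcard : Nat.card A₀ = s * m)
    {d : Γ} (hd : π d ∈ torsionIn A₀ s) (a : A) : d • a - a ∈ torsionIn A₀ s := by
  have : Finite Γ := Finite.of_equiv A π.symm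
  have hcop {n n' : ℕ} (hn : n.Coprime n') :
      (Nat.card (torsionIn A₀ n)).Coprime (Nat.card (torsionIn A₀ n')) :=
    Nat.coprime_of_dvd fun q hq h h' => hq.not_dvd_one <| hn ▸ Nat.dvd_gcd
      (prime_dvd_of_dvd_card_torsionIn hq h) (prime_dvd_of_dvd_card_torsionIn hq h')
  have hkill {b : A} (hb : b ∈ A₀) : (s * m) • b = 0 := by
    rw [← hcard]
    exact congrArg Subtype.val (card_nsmul_eq_zero' (G := A₀) (x := ⟨b, hb⟩))
  have hord {n : ℕ} {g : Γ} (hg : π g ∈ torsionIn A₀ n) :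
      orderOf g ∣ Nat.card (torsionIn A₀ n) := by
    rw [← card_cocyclePreimage hπ _ (smul_mem_torsionIn hA₀ n)]
    exact Subgroup.orderOf_dvd_natCard _ hg
  have hzero {b : A} (h : s • b = 0) (h' : m • b = 0) : b = 0 := by
    have := Nat.dvd_gcd (addOrderOf_dvd_of_nsmul_eq_zero h) (addOrderOf_dvd_of_nsmul_eq_zero h')
    rw [hsm] at this
    exact AddMonoid.addOrderOf_eq_one_iff.1 (Nat.dvd_one.1 this)
  have htriv {g : Γ} (hg : π g ∈ torsionIn A₀ s) {b : A} (hb : b ∈ torsionIn A₀ m) :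
      g • b = b := by
    obtain ⟨k, rfl⟩ := π.surjective b
    have hcomm : Commute (⟨g, hD g hg.1⟩ : D) ⟨k, hD k hb.1⟩ := by
      apply Group.IsNilpotent.commute_of_coprime_orderOf
      rw [Subgroup.orderOf_mk, Subgroup.orderOf_mk]
      exact (hcop hsm).coprime_dvd_left (hord hg) |>.coprime_dvd_right (hord hb)
    have hgk : g * k = k * g := congrArg Subtype.val hcomm
    have h := hπ g k
    rw [hgk, hπ] at h
    have h' : g • π k - π k = k • π g - π g := by
      rw [sub_eq_sub_iff_add_eq_add, add_comm, ← h, add_comm]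
    have h1 := (torsionIn A₀ m).sub_mem (smul_mem_torsionIn hA₀ m g _ hb) hb
    have h2 := (torsionIn A₀ s).sub_mem (smul_mem_torsionIn hA₀ s k _ hg) hg
    rw [← h'] at h2
    exact sub_eq_zero.1 (hzero h2.2 h1.2)
  refine ⟨hA₀ d a, ?_⟩
  change s • (d • a - a) = 0
  have hm : s • (d • a - a) ∈ torsionIn A₀ m :=
    ⟨A₀.nsmul_mem (hA₀ d a) s, by
      change m • s • (d • a - a) = 0
      rw [smul_smul, mul_comm, hkill (hA₀ d a)]⟩
  have hpow (n : ℕ) : s • (d ^ n • a - a) = n • s • (d • a - a) := by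
    induction n with
    | zero => simp
    | succ n ih =>
      have : d ^ (n + 1) • a - a = d • (d ^ n • a - a) + (d • a - a) := by
        rw [pow_succ', mul_smul, smul_sub]; abel
      rw [this, smul_add, smul_comm s d, ih, smul_comm d n, htriv hd hm, succ_nsmul]
  have h1 : orderOf d • s • (d • a - a) = 0 := by
    rw [← hpow, pow_orderOf_eq_one, one_smul, sub_self, smul_zero]
  have h2 : Nat.card (torsionIn A₀ m) • s • (d • a - a) = 0 :=
    congrArg Subtype.val (card_nsmul_eq_zero' (G := torsionIn A₀ m) (x := ⟨_, hm⟩))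
  have h3 := Nat.dvd_gcd (addOrderOf_dvd_of_nsmul_eq_zero h1) (addOrderOf_dvd_of_nsmul_eq_zero h2)
  rw [(hcop hsm).coprime_dvd_left (hord hd)] at h3
  exact AddMonoid.addOrderOf_eq_one_iff.1 (Nat.dvd_one.1 h3)

end BijectiveCocycle

namespace LeftQuasigroup

/-! ### The finite abelian group attached to a finite cycle set -/

section Linearization

variable {X : Type v} {Q : LeftQuasigroup X}

/-- The congruence `λ_a = λ_b` on the free commutative monoid of multisets. -/
noncomputable def multisetCon (hc : Q.CycleIdentity) : AddCon (Multiset X) where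
  toSetoid := Setoid.ker (multisetPerm hc)
  add' := fun {a b c d} h h' => by
    change multisetPerm hc (a + c) = multisetPerm hc (b + d)
    rw [multisetPerm_add_congr hc h, add_comm, multisetPerm_add_congr hc h', add_comm]

/-- The permutation group of a finite cycle set acts on a finite abelian group `A` generated by
a copy of `X`, and has a bijective cocycle `π` to it. In other words, `𝒢(X)` is a left brace. -/
theorem exists_bijective_cocycle [Finite X] (hc : Q.CycleIdentity) :
    ∃ (A : Type v) (_ : AddCommGroup A) (_ : DistribMulAction Q.permGroup A)
      (π : Q.permGroup ≃ A) (ι : X → A),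
      (∀ g h, π (g * h) = π g + g • π h) ∧ (∀ x, π (Q.sigmaG x)⁻¹ = ι x) ∧
      (∀ (g : Q.permGroup) x, g • ι x = ι ((g : Equiv.Perm X) x)) ∧
      AddSubgroup.closure (Set.range ι) = ⊤ := by
  let c := multisetCon hc
  have hc_eq {a b : Multiset X} : (a : c.Quotient) = b ↔ multisetPerm hc a = multisetPerm hc b :=
    AddCon.eq c
  have hneg (a : c.Quotient) : ∃ b : c.Quotient, b + a = 0 := by
    induction a using AddCon.induction_on with
    | H a =>
      obtain ⟨d, hd⟩ := exists_multisetPerm_add_eq_one hc a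
      refine ⟨(d : c.Quotient), ?_⟩
      rw [← AddCon.coe_add, ← AddCon.coe_zero, hc_eq, add_comm, hd, multisetPerm_zero]
  choose neg hneg using hneg
  let _ : Neg c.Quotient := ⟨neg⟩
  let instA : AddCommGroup c.Quotient :=
    { (inferInstance : AddCommMonoid c.Quotient) with
      neg_add_cancel := hneg
      zsmul := zsmulRec }
  let act (g : Q.permGroup) : c.Quotient →+ c.Quotient :=
    c.lift (c.mk'.comp (Multiset.mapAddMonoidHom (g : Equiv.Perm X))) fun a b h =>
      hc_eq.2 (multisetPerm_map_congr hc g.2 h)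
  let instM : DistribMulAction Q.permGroup c.Quotient :=
    { smul := fun g a => act g a
      one_smul := fun a => by
        induction a using AddCon.induction_on with
        | H a => exact congrArg _ (Multiset.map_id a)
      mul_smul := fun g h a => by
        induction a using AddCon.induction_on with
        | H a =>
          exact congrArg (fun b : Multiset X => (b : c.Quotient))
            (Multiset.map_map (g : Equiv.Perm X) (h : Equiv.Perm X) a).symm
      smul_zero := fun g => map_zero (act g)
      smul_add := fun g => map_add (act g) }
  let θ : c.Quotient → Q.permGroup := Quotient.lift
    (fun a => ⟨(multisetPerm hc a)⁻¹, inv_mem (multisetPerm_mem_permGroup hc a)⟩)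
    fun a b h => Subtype.ext (congrArg (·⁻¹) h)
  have θ_coe (a : Multiset X) : (θ (a : c.Quotient) : Equiv.Perm X) = (multisetPerm hc a)⁻¹ := rfl
  have hθ : Function.Bijective θ := by
    constructor
    · intro a b h
      induction a using AddCon.induction_on with
      | H a =>
        induction b using AddCon.induction_on with
        | H b => exact hc_eq.2 (inv_injective (congrArg Subtype.val h))
    · intro g
      obtain ⟨a, ha⟩ := exists_multisetPerm_eq hc (inv_mem g.2)
      exact ⟨(a : c.Quotient), Subtype.ext (by rw [θ_coe, ha, inv_inv])⟩
  have hθ_mul (a b : c.Quotient) : θ (a + θ a • b) = θ a * θ b := by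
    induction a using AddCon.induction_on with
    | H a =>
      induction b using AddCon.induction_on with
      | H b =>
        apply Subtype.ext
        change (multisetPerm hc (a + b.map ⇑(multisetPerm hc a)⁻¹))⁻¹ =
          (multisetPerm hc a)⁻¹ * (multisetPerm hc b)⁻¹
        rw [multisetPerm_add_map, mul_inv_rev]
  let π : Q.permGroup ≃ c.Quotient := (Equiv.ofBijective θ hθ).symm
  have hπθ (a : c.Quotient) : π (θ a) = a := (Equiv.ofBijective θ hθ).symm_apply_apply a
  refine ⟨c.Quotient, instA, instM, π, fun x => (({x} : Multiset X) : c.Quotient), ?_, ?_, ?_, ?_⟩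
  · intro g h
    obtain ⟨a, rfl⟩ := hθ.2 g
    obtain ⟨b, rfl⟩ := hθ.2 h
    rw [← hθ_mul, hπθ, hπθ, hπθ]
  · intro x
    change π (Q.sigmaG x)⁻¹ = (({x} : Multiset X) : c.Quotient)
    rw [← hπθ (({x} : Multiset X) : c.Quotient)]
    refine congrArg π (Subtype.ext ?_)
    rw [θ_coe, multisetPerm_singleton]
    rfl
  · intro g x
    exact congrArg _ (Multiset.map_singleton _ x)
  · rw [eq_top_iff]
    rintro a -
    induction a using AddCon.induction_on with
    | H a =>
      induction a using Multiset.induction_on with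
      | empty => exact zero_mem _
      | cons x a ih =>
        rw [← Multiset.singleton_add, AddCon.coe_add]
        exact add_mem (AddSubgroup.subset_closure ⟨x, rfl⟩) ih

end Linearization

/-! ### Simple cycle sets with nilpotent regular displacement group -/

section Simple

variable {X : Type v} {Q : LeftQuasigroup X}

theorem dis_eq_bot_of_sigma_eq (h : ∀ x y, Q.sigma x = Q.sigma y) : Q.dis = ⊥ := by
  rw [eq_bot_iff]
  apply Subgroup.normalClosure_le_normal
  rintro g ⟨x, y, hg⟩
  refine Subtype.ext ?_
  rw [hg, h x y, mul_inv_cancel]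
  rfl

/-- The orbits of a normal subgroup `P` of `𝒢(X)` form a congruence if `σ_x⁻¹ σ_{g x}` lies in `P`
for all `g` in `P`. -/
theorem isCongruence_orbitRel [Finite X] {P : Subgroup Q.permGroup} (hP : P.Normal)
    (h : ∀ g ∈ P, ∀ x, (Q.sigmaG x)⁻¹ * Q.sigmaG ((g : Equiv.Perm X) x) ∈ P) :
    Q.IsCongruence (MulAction.orbitRel P X) := by
  refine isCongruence_of_op fun x x' y y' hx hy => ?_
  obtain ⟨⟨g, hg⟩, rfl⟩ := hx
  obtain ⟨⟨k, hk⟩, rfl⟩ := hy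
  refine ⟨⟨Q.sigmaG ((g : Equiv.Perm X) x') * k * (Q.sigmaG ((g : Equiv.Perm X) x'))⁻¹ *
    (Q.sigmaG ((g : Equiv.Perm X) x') * (Q.sigmaG x')⁻¹),
    mul_mem (hP.conj_mem k hk _) (hP.mem_comm (h g hg x'))⟩, ?_⟩
  have : Q.sigmaG ((g : Equiv.Perm X) x') * k * (Q.sigmaG ((g : Equiv.Perm X) x'))⁻¹ *
      (Q.sigmaG ((g : Equiv.Perm X) x') * (Q.sigmaG x')⁻¹) * Q.sigmaG x' =
      Q.sigmaG ((g : Equiv.Perm X) x') * k := by group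
  exact congrArg (fun u : Q.permGroup => (u : Equiv.Perm X) y') this

theorem exists_card_dis_eq_prime_pow [Finite X] (hcs : Q.IsCycleSet) (hs : Q.IsSimple)
    (hnil : Group.IsNilpotent Q.dis) (hreg : Q.DisIsRegular) :
    ∃ p k : ℕ, p.Prime ∧ Nat.card Q.dis = p ^ k := by
  obtain ⟨A, _, _, π, ι, hπ, hπι, hι, hspan⟩ := exists_bijective_cocycle hcs.cycle
  have : Finite A := Finite.of_equiv _ π
  let A₀ : AddSubgroup A := AddSubgroup.closure {a | ∃ x y, a = ι x - ι y}
  have hA₀ (g : Q.permGroup) (a : A) : g • a - a ∈ A₀ := by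
    have ha : a ∈ AddSubgroup.closure (Set.range ι) := hspan ▸ AddSubgroup.mem_top a
    induction ha using AddSubgroup.closure_induction with
    | mem a ha =>
      obtain ⟨x, rfl⟩ := ha
      exact AddSubgroup.subset_closure ⟨_, x, by rw [hι]⟩
    | zero => simp
    | add a b _ _ iha ihb => rw [smul_add, add_sub_add_comm]; exact add_mem iha ihb
    | neg a _ ih => rw [smul_neg, ← neg_sub']; exact neg_mem ih
  have hπσ (x z : X) : π ((Q.sigmaG x)⁻¹ * Q.sigmaG z) =
      ι x - ι ((Q.sigma x)⁻¹ (Q.op z z)) := by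
    have h : π (Q.sigmaG z) = -ι (Q.op z z) := by
      have := cocycle_inv hπ (Q.sigmaG z)
      rw [hπι, hι] at this
      rw [← neg_eq_iff_eq_neg]
      exact this.symm
    rw [hπ, hπι, h, smul_neg, hι, sub_eq_add_neg]
    rfl
  -- The set `π(Dis(X))` is stable under adding differences of generators, so it contains `A₀`.
  have hstep (x y : X) (a : A) (ha : π.symm a ∈ Q.dis) :
      π.symm (a + (ι x - ι y)) ∈ Q.dis := by
    let g := π.symm a
    -- By non-degeneracy, every difference of two generators is `π (σ_u⁻¹ σ_z)` for some `u`, `z`.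
    let u := (g : Equiv.Perm X)⁻¹ x
    obtain ⟨z, hz⟩ := hcs.nondegenerate.2 (Q.op u ((g : Equiv.Perm X)⁻¹ y))
    have hz' : (Q.sigma u)⁻¹ (Q.op z z) = (g : Equiv.Perm X)⁻¹ y := by
      rw [show Q.op z z = Q.sigma u ((g : Equiv.Perm X)⁻¹ y) from hz]
      exact Equiv.symm_apply_apply _ _
    have : π.symm (a + (ι x - ι y)) = g * ((Q.sigmaG u)⁻¹ * Q.sigmaG z) := by
      rw [π.symm_apply_eq, hπ, hπσ, hz', smul_sub, hι, hι, π.apply_symm_apply]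
      congr 3 <;> exact (Equiv.apply_symm_apply _ _).symm
    rw [this]
    exact mul_mem ha (Q.sigmaG_inv_mul_mem_dis u z)
  have hadd (b : A) (hb : b ∈ A₀) (a : A) : π.symm a ∈ Q.dis ↔ π.symm (a + b) ∈ Q.dis := by
    induction hb using AddSubgroup.closure_induction generalizing a with
    | mem b hb =>
      obtain ⟨x, y, rfl⟩ := hb
      exact ⟨hstep x y a, fun h => by
        simpa [add_assoc] using hstep y x _ h⟩
    | zero => rw [add_zero]
    | add b c _ _ ihb ihc => rw [ihb, ihc, add_assoc]
    | neg b _ ih => rw [ih (a + -b), neg_add_cancel_right]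
  have hD (g : Q.permGroup) (hg : π g ∈ A₀) : g ∈ Q.dis := by
    have h0 : π.symm 0 = 1 := by rw [π.symm_apply_eq, cocycle_one hπ]
    simpa using (hadd (π g) hg 0).1 (by rw [h0]; exact one_mem _)
  by_cases hone : Nat.card A₀ = 1
  · refine ⟨2, 0, Nat.prime_two, ?_⟩
    rw [dis_eq_bot_of_sigma_eq fun x y => ?_, Subgroup.card_bot, pow_zero]
    have h : ι x - ι y ∈ A₀ := AddSubgroup.subset_closure ⟨x, y, rfl⟩
    rw [AddSubgroup.card_eq_one.1 hone, AddSubgroup.mem_bot, sub_eq_zero, ← hπι, ← hπι,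
      π.apply_eq_iff_eq, inv_inj] at h
    exact congrArg Subtype.val h
  obtain ⟨p, hp, hdvd⟩ := Nat.exists_prime_and_dvd hone
  obtain ⟨n, m, hpm, hcard⟩ := Nat.exists_eq_pow_mul_and_not_dvd
    (Nat.card_pos (α := A₀)).ne' p hp.ne_one
  have hcop : (p ^ n).Coprime m := ((hp.coprime_iff_not_dvd).2 hpm).pow_left n
  let B := torsionIn A₀ (p ^ n)
  have hB := smul_mem_torsionIn hA₀ (p ^ n)
  let P : Subgroup Q.permGroup := cocyclePreimage hπ B hB
  have hPD : P ≤ Q.dis := fun g hg => hD g hg.1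
  have hPB {d : Q.permGroup} (hd : d ∈ P) (a : A) : d • a - a ∈ B :=
    smul_sub_mem_torsionIn hπ hA₀ hD hnil hcop hcard hd a
  have hPn : P.Normal := by
    refine ⟨fun d hd g => ?_⟩
    have : π (g * d * g⁻¹) = g • (π d + (d • π g⁻¹ - π g⁻¹)) := by
      have h1 : π g = -(g • π g⁻¹) := by rw [cocycle_inv hπ, neg_neg]
      rw [hπ, hπ, mul_smul, h1, smul_add, smul_sub]
      abel
    change π (g * d * g⁻¹) ∈ B
    rw [this]
    exact hB _ _ (B.add_mem hd (hPB hd _))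
  have hPσ (g) (hg : g ∈ P) (x : X) :
      (Q.sigmaG x)⁻¹ * Q.sigmaG ((g : Equiv.Perm X) x) ∈ P := by
    have hmem : (Q.sigmaG ((g : Equiv.Perm X) x))⁻¹ = (Q.sigmaG x)⁻¹ *
        (Q.sigmaG x * (Q.sigmaG ((g : Equiv.Perm X) x))⁻¹) := by group
    have h := hPB hg (ι x)
    rw [hι, ← hπι, hmem, hπ, hπι, add_sub_cancel_left] at h
    have h' : Q.sigmaG x * (Q.sigmaG ((g : Equiv.Perm X) x))⁻¹ ∈ P := by
      change π _ ∈ B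
      simpa using hB (Q.sigmaG x) _ h
    exact hPn.mem_comm (by simpa using inv_mem h')
  refine ⟨p, ?_⟩
  rcases hs.2 _ (isCongruence_orbitRel hPn hPσ) with h | h
  · -- `P` acts trivially on `X`, against Cauchy's theorem in `A₀`.
    exfalso
    have hP1 : P = ⊥ := by
      rw [Subgroup.eq_bot_iff_forall]
      intro g hg
      refine Subtype.ext (Equiv.ext fun x => ?_)
      have : MulAction.orbitRel P X ((g : Equiv.Perm X) x) x := ⟨⟨g, hg⟩, rfl⟩
      rw [h] at this
      exact this
    have hB1 : Nat.card B = 1 := by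
      rw [← card_cocyclePreimage hπ B hB]
      exact Subgroup.card_eq_one.2 hP1
    have := Fact.mk hp
    obtain ⟨b, hb⟩ := exists_prime_addOrderOf_dvd_card' p hdvd
    have hn : n ≠ 0 := by
      rintro rfl
      rw [pow_zero, one_mul] at hcard
      exact hpm (hcard ▸ hdvd)
    have hbB : (b : A) ∈ B := ⟨b.2, by
      have : p ^ n • b = 0 := addOrderOf_dvd_iff_nsmul_eq_zero.1 (hb ▸ dvd_pow_self p hn)
      exact congrArg Subtype.val this⟩
    rw [AddSubgroup.card_eq_one.1 hB1, AddSubgroup.mem_bot] at hbB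
    have : b = 0 := Subtype.ext hbB
    rw [this, addOrderOf_zero] at hb
    exact hp.ne_one hb.symm
  · have hPeq : P = Q.dis := by
      refine le_antisymm hPD fun g hg => ?_
      obtain ⟨x⟩ := Q.nonempty
      have : MulAction.orbitRel P X ((g : Equiv.Perm X) x) x := by rw [h]; trivial
      obtain ⟨⟨k, hk⟩, hkx⟩ := this
      have := (hreg x ((g : Equiv.Perm X) x)).unique (y₁ := ⟨g, hg⟩) (y₂ := ⟨k, hPD hk⟩) rfl hkx
      rw [show g = k from congrArg Subtype.val this]
      exact hk
    have hBp : ∀ {q : ℕ}, q.Prime → q ∣ Nat.card B → q = p := fun hq h =>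
      (Nat.prime_dvd_prime_iff_eq hq hp).1
        (hq.dvd_of_dvd_pow (prime_dvd_of_dvd_card_torsionIn hq h))
    refine ⟨(Nat.card B).primeFactorsList.length, hp, ?_⟩
    rw [← hPeq, card_cocyclePreimage]
    exact Nat.eq_prime_pow_of_unique_prime_dvd Nat.card_pos.ne' hBp

/-- The right-linear form: if `t` in `𝒢(X)` fixes the base point `e` and differs from `σ_e` by an
element of `Dis(X)`, then `g ↦ g(e)` carries `φ(g) = σ_{g(e)} t⁻¹` and `ψ(g) = t g t⁻¹` to the
operation of `X`. -/
theorem exists_rightLinear_isomorphic [Finite X] (hcs : Q.IsCycleSet) (hs : Q.IsSimple)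
    (hreg : Q.DisIsRegular) : ∃ (φ : Equiv.Perm Q.dis) (ψ : MulAut Q.dis),
      Q.IsIsomorphic (rightLinear φ ψ) := by
  obtain ⟨e⟩ := Q.nonempty
  let ev : Q.dis → X := fun g => ((g : Q.permGroup) : Equiv.Perm X) e
  have hev : Function.Bijective ev := by
    rw [Function.bijective_iff_existsUnique]
    exact fun y => hreg e y
  obtain ⟨c, hc⟩ := hev.2 (Q.op e e)
  let t : Q.permGroup := (c : Q.permGroup)⁻¹ * Q.sigmaG e
  have ht : (t : Equiv.Perm X) e = e := by
    change ((c : Q.permGroup) : Equiv.Perm X)⁻¹ (Q.op e e) = e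
    rw [← hc]
    exact Equiv.symm_apply_apply _ _
  let f : Q.dis → Q.dis := fun g => ⟨Q.sigmaG (ev g) * t⁻¹, by
    have h := mul_mem (Q.sigmaG_mul_inv_mem_dis (ev g) e) c.2
    simpa [t, mul_assoc] using h⟩
  have hf : Function.Injective f := by
    intro g h hgh
    have hσ : Q.sigmaG (ev g) = Q.sigmaG (ev h) := mul_right_cancel (congrArg Subtype.val hgh)
    rcases hs.2 _ (isCongruence_ker_sigma hcs.cycle) with hr | hr
    · have : Setoid.ker Q.sigma (ev g) (ev h) := congrArg Subtype.val hσ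
      rw [hr] at this
      exact hev.1 this
    · -- If all `σ_x` coincide, then `Dis(X)` is trivial.
      have hbot : Q.dis = ⊥ := dis_eq_bot_of_sigma_eq fun x y => by
        have : Setoid.ker Q.sigma x y := by rw [hr]; trivial
        exact this
      have h1 (k : Q.dis) : (k : Q.permGroup) = 1 := by
        exact Subgroup.mem_bot.1 (hbot ▸ k.2)
      exact Subtype.ext ((h1 g).trans (h1 h).symm)
  let φ : Equiv.Perm Q.dis := Equiv.ofBijective f hf.bijective_of_finite
  let ψ : MulAut Q.dis := MulAut.conjNormal t
  let E : Q.dis ≃ X := Equiv.ofBijective ev hev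
  refine ⟨φ, ψ, E.symm, fun x y => ?_⟩
  obtain ⟨g, rfl⟩ := E.surjective x
  obtain ⟨h, rfl⟩ := E.surjective y
  rw [E.symm_apply_eq, E.symm_apply_apply, E.symm_apply_apply]
  have hval : ((φ g * ψ h : Q.dis) : Q.permGroup) = Q.sigmaG (ev g) * h * t⁻¹ := by
    rw [Subgroup.coe_mul, MulAut.conjNormal_apply]
    change Q.sigmaG (ev g) * t⁻¹ * (t * h * t⁻¹) = _
    group
  have ht' : ((t⁻¹ : Q.permGroup) : Equiv.Perm X) e = e := by
    nth_rewrite 1 [← ht]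
    exact Equiv.symm_apply_apply _ _
  change Q.op (ev g) (ev h) = (((φ g * ψ h : Q.dis) : Q.permGroup) : Equiv.Perm X) e
  rw [hval, Subgroup.coe_mul, Equiv.Perm.mul_apply, ht']
  rfl

theorem IsIsomorphic.cycleIdentity {Y : Type*} {R : LeftQuasigroup Y} (h : Q.IsIsomorphic R)
    (hc : Q.CycleIdentity) : R.CycleIdentity := by
  obtain ⟨e, he⟩ := h
  intro x y z
  obtain ⟨x, rfl⟩ := e.surjective x
  obtain ⟨y, rfl⟩ := e.surjective y
  obtain ⟨z, rfl⟩ := e.surjective z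
  simp only [← he, hc x y z]

end Simple

end LeftQuasigroup

/-! ### The correspondence -/

theorem mainTheorem3 :
    (∀ (G : Type u) [Group G] (p k : ℕ) (φ : Equiv.Perm G) (ψ : MulAut G),
      p.Prime → Nat.card G = p ^ k → RightLinearCondition φ ψ → NoInvariantNormalSubgroup φ ψ →
        (LeftQuasigroup.rightLinear φ ψ).IsCycleSet ∧
        (LeftQuasigroup.rightLinear φ ψ).IsSimple ∧
        (1 ≤ k → ¬ (LeftQuasigroup.rightLinear φ ψ).IsTrivial) ∧
        Nonempty ((LeftQuasigroup.rightLinear φ ψ).dis ≃* G)) ∧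
    (∀ (X : Type v) [Finite X] (Q : LeftQuasigroup X),
      Q.IsCycleSet → Q.IsSimple → Group.IsNilpotent Q.dis → Q.DisIsRegular →
        ∃ (G : Type v) (_ : Group G) (p k : ℕ) (φ : Equiv.Perm G) (ψ : MulAut G),
          p.Prime ∧ Nat.card G = p ^ k ∧ RightLinearCondition φ ψ ∧
          NoInvariantNormalSubgroup φ ψ ∧
          Q.IsIsomorphic (LeftQuasigroup.rightLinear φ ψ)) := by
  refine ⟨fun G _ p k φ ψ hp hcard h1 h2 => ?_, fun X _ Q hcs hs hnil hreg => ?_⟩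
  · have : Finite G := Nat.finite_of_card_ne_zero (hcard ▸ pow_ne_zero k hp.ne_zero)
    have hc := LeftQuasigroup.cycleIdentity_rightLinear_iff.2 h1
    refine ⟨⟨hc, hc.bijective_square⟩, LeftQuasigroup.isSimple_rightLinear h2, fun hk => ?_,
      LeftQuasigroup.nonempty_dis_rightLinear_mulEquiv φ ψ⟩
    have : Nontrivial G := by
      rw [← Finite.one_lt_card_iff_nontrivial, hcard]
      exact Nat.one_lt_pow (by omega) hp.one_lt
    exact LeftQuasigroup.not_isTrivial_rightLinear
  · obtain ⟨p, k, hp, hcard⟩ := LeftQuasigroup.exists_card_dis_eq_prime_pow hcs hs hnil hreg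
    obtain ⟨φ, ψ, hi⟩ := LeftQuasigroup.exists_rightLinear_isomorphic hcs hs hreg
    exact ⟨Q.dis, inferInstance, p, k, φ, ψ, hp, hcard,
      LeftQuasigroup.cycleIdentity_rightLinear_iff.1 (hi.cycleIdentity hcs.cycle),
      LeftQuasigroup.noInvariantNormalSubgroup_of_isSimple hs hi, hi⟩
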